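/- There is an absolute constant $C>0$ such that the following holds. Let $\Sigma$ be an alphabet, let $\bot\notin\Sigma$ be a wildcard symbol, and let $S\in(\Sigma\cup\{\bot\})^n$ be a string with at most $k$ wildcards; let $\mathcal W=\{w : S[w]=\bot\}$. Call $p$ with $p+\lfloor n/2\rfloor\le n$ a candidate if $$\mathrm{HAM}\bigl(S[1,\lfloor n/2\rfloor],\,S[p+1,p+\lfloor n/2\rfloor]\bigr)\le 2k,$$ where $\mathrm{HAM}$ is the Hamming distance and $\bot$ counts as an ordinary symbol. Fix an integer $j\ge 0$, and consider the candidates in the interval $$\left[\frac{jn}{4(2k\log_2 n+1)}+1,\ \frac{(j+1)n}{4(2k\log_2 n+1)}\right).$$ If there are any, let $t_{\min}$ and $t_{\max}$ be the smallest and the largest of them, let $\pi_j$ be the greatest common divisor of all their differences, and let $H_j=\{t_{\min},t_{\min}+\pi_j,t_{\min}+2\pi_j,\dots,t_{\max}\}$ (just $\{t_{\min}\}$ if there is only one candidate); otherwise let $H_j=\emptyset$. For $t\in H_j$ and $w\in\mathcal W$, let $\sigma_t(w)$ be the letter $c\in\Sigma$ that $t$ forces on the wildcard at $w$: $\sigma_t(w)=c$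 if the symbols $S[w+at]$ ($a\in\mathbb Z$, $1\le w+at\le n$) that are not wildcards are all equal to $c$ and there is at least one of them; $\sigma_t(w)$ is undefined if there are none or if two of them differ (in the latter case no assignment of letters to the wildcards gives $S$ the period $t$). Then the number of distinct values is bounded by $$\bigl|\{\sigma_t(w) : t\in H_j,\ w\in\mathcal W,\ \sigma_t(w)\text{ defined}\}\bigr|\le C\,k^2\log_2 n .$$ -/

import Mathlib

noncomputable section

namespace WildcardPeriod

/-- The substring of length `x` of `S` starting after the first `a` symbols, i.e. `S[a+1, a+x]`
in one-based notation. A string of length `n` over the alphabet `A` with wildcards is a function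
`Fin n → Option A`, with `none` as the wildcard character. -/
def substr {A : Type*} {n : ℕ} (S : Fin n → Option A) (a x : ℕ) (h : a + x ≤ n) :
    Fin x → Option A :=
  fun i => S ⟨a + i, by omega⟩

/-- The set of positions of the wildcard characters. -/
def wildcards {A : Type*} {n : ℕ} (S : Fin n → Option A) : Set (Fin n) :=
  {w | S w = none}

open Classical in
/-- `p` is a candidate wildcard-period: `HAM(S[1, n/2], S[p+1, p+n/2]) ≤ 2k`, where the wildcard
counts as one more symbol of the alphabet. -/
def IsCandidate {A : Type*} {n : ℕ} (S : Fin n → Option A) (k p : ℕ) : Prop :=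
  ∃ h : p + n / 2 ≤ n,
    hammingDist (substr S 0 (n / 2) (by omega)) (substr S p (n / 2) h) ≤ 2 * k

/-- The length `n / (4 (2 k log n + 1))` that separates the intervals of candidate periods. -/
def width (n k : ℕ) : ℝ :=
  n / (4 * (2 * k * Real.logb 2 n + 1))

/-- The integers in the `j`-th interval
`[j n / (4 (2 k log n + 1)) + 1, (j + 1) n / (4 (2 k log n + 1)))`. -/
def interval (n k j : ℕ) : Set ℕ :=
  {p | j * width n k + 1 ≤ (p : ℝ) ∧ (p : ℝ) < (j + 1) * width n k}

open Classical in
/-- The candidate wildcard-periods that lie in the `j`-th interval. -/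
def candidates {A : Type*} {n : ℕ} (S : Fin n → Option A) (k j : ℕ) : Finset ℕ :=
  {p ∈ Finset.range (n + 1) | p ∈ interval n k j ∧ IsCandidate S k p}

/-- The greatest common divisor `π_j` of all differences of candidates in the `j`-th interval
(pairs in the wrong order contribute `0`, which does not change the gcd; it is `0` if there is at
most one candidate). -/
def commonDiff {A : Type*} {n : ℕ} (S : Fin n → Option A) (k j : ℕ) : ℕ :=
  (candidates S k j ×ˢ candidates S k j).gcd fun x => x.1 - x.2

/-- The arithmetic progression `t, t + π_j, t + 2 π_j, …, z` that represents the candidates in the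
`j`-th interval, where `t` is the smallest and `z` the largest of them. It contains all of them. -/
def progression {A : Type*} {n : ℕ} (S : Fin n → Option A) (k j : ℕ) : Set ℕ :=
  {r | ∃ t z : ℕ, IsLeast (candidates S k j : Set ℕ) t ∧ IsGreatest (candidates S k j : Set ℕ) z ∧
    r ≤ z ∧ ∃ a : ℕ, r = t + a * commonDiff S k j}

/-- `c` is the forced assignment `σ_t(w)` of position `w` with respect to `t`: some symbol
`S[w + a t]` with `a` an integer is the letter `c`, and every symbol `S[w + a t]` that is not a
wildcard is `c`. -/
def IsForced {A : Type*} {n : ℕ} (S : Fin n → Option A) (t : ℕ) (w : Fin n) (c : A) : Prop :=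
  (∃ y : Fin n, (∃ a : ℤ, (y : ℤ) = w + a * t) ∧ S y = some c) ∧
    ∀ y : Fin n, (∃ a : ℤ, (y : ℤ) = w + a * t) → S y = none ∨ S y = some c

/-- The set `{σ_t(w)}` of all forced assignments of wildcards, over all `t` in the `j`-th
progression and all wildcard positions `w`. -/
def forcedValues {A : Type*} {n : ℕ} (S : Fin n → Option A) (k j : ℕ) : Set A :=
  {c | ∃ t ∈ progression S k j, ∃ w ∈ wildcards S, IsForced S t w c}

end WildcardPeriod

end

namespace WildcardPeriod

open Finset

/-! A candidate shift of `S` may fail at `2k` places, so `S` itself need not be periodic. One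
follows instead the predicate "the symbol at `x` lies in `R`", where `R` is a set of symbols closed
under mismatches: a candidate shift preserves it exactly on the first half. Closing `R` costs one
symbol per mismatch pair (`exists_closed_superset`), and O(log n) candidates already generate `π_j`
(`exists_subset_gcd_eq`), so the cost is O(k log n). By Fine and Wilf the predicate has period `π_j`
on the first half; one seed symbol per residue class then puts every symbol of that class there into
`R`.

Let `t` force a value on `w`. If the first two positions of the class of `w` modulo `t` are both
wildcards, this pair determines `t` and the value: at most `k²` values. Otherwise the value occurs
at one of these positions, which, after at most one shift back by `tmax`, is congruent to some `w -
b * tmin` with `b` about `n / t` at most. For `j ≥ 1`, `n / t` is O(k log n), which gives O(k² log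
n) classes. For `j = 0`, `tmin` is short enough to be a period too, and modulo `gcd(π_0, tmin)` only
the `k` classes of the wildcards remain. -/

/-! ### Closing a vertex set under edges -/

open Classical in
/-- A finite set of vertices together with everything reachable from it along the edges `E`
has at most `#R + #E` elements. -/
theorem exists_closed_superset {α : Type*} (E : Finset (α × α)) (R : Finset α) :
    ∃ R' : Finset α, R ⊆ R' ∧ R'.card ≤ R.card + E.card ∧
      ∀ e ∈ E, e.1 ∈ R' ↔ e.2 ∈ R' := by
  induction hm : E.card generalizing E R with
  | zero =>
    rw [Finset.card_eq_zero] at hm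
    exact ⟨R, subset_rfl, by simp, by simp [hm]⟩
  | succ m ih =>
    by_cases hc : ∀ e ∈ E, e.1 ∈ R ↔ e.2 ∈ R
    · exact ⟨R, subset_rfl, by omega, hc⟩
    · push Not at hc
      obtain ⟨e, he, hne⟩ := hc
      have hcard : (E.erase e).card = m := by rw [Finset.card_erase_of_mem he]; omega
      -- Adding the missing endpoint settles `e` for good, because the set only grows; each edge
      -- costs at most one vertex.
      have key : ∀ v, (e.1 ∈ insert v R ∧ e.2 ∈ insert v R) →
          ∃ R' : Finset α, R ⊆ R' ∧ R'.card ≤ R.card + (m + 1) ∧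
            ∀ e ∈ E, e.1 ∈ R' ↔ e.2 ∈ R' := by
        intro v hv
        obtain ⟨R', hR, hR', hcl⟩ := ih (E.erase e) (insert v R) hcard
        refine ⟨R', (Finset.subset_insert _ _).trans hR, ?_, ?_⟩
        · have := Finset.card_insert_le v R
          omega
        · intro e' he'
          by_cases h : e' = e
          · subst h
            exact iff_of_true (hR hv.1) (hR hv.2)
          · exact hcl e' (Finset.mem_erase.2 ⟨h, he'⟩)
      rcases hne with ⟨h1, h2⟩ | ⟨h1, h2⟩
      · exact key e.2 ⟨by simp [h1], by simp⟩
      · exact key e.1 ⟨by simp, by simp [h2]⟩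

/-! ### Periods of predicates -/

/-- The predicate `F` has period `d` on the positions below `h`. -/
def HasPeriod (F : ℕ → Prop) (h d : ℕ) : Prop :=
  ∀ x, x + d < h → (F x ↔ F (x + d))

/-- Go back by `p` and forward by `q`, or in the other order when `x < p`; `p + q ≤ h` keeps the
detour below `h`. -/
theorem HasPeriod.sub {F : ℕ → Prop} {h p q : ℕ} (hp : HasPeriod F h p) (hq : HasPeriod F h q)
    (hpq : p ≤ q) (hh : p + q ≤ h) : HasPeriod F h (q - p) := by
  intro x hx
  by_cases hxp : p ≤ x
  · have h1 := hp (x - p) (by omega)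
    have h2 := hq (x - p) (by omega)
    rw [show x - p + p = x by omega] at h1
    rw [show x - p + q = x + (q - p) by omega] at h2
    exact h1.symm.trans h2
  · have h1 := hq x (by omega)
    have h2 := hp (x + (q - p)) (by omega)
    rw [show x + (q - p) + p = x + q by omega] at h2
    exact h1.trans h2.symm

/-- The periodicity lemma of Fine and Wilf, for predicates. -/
theorem HasPeriod.gcd {F : ℕ → Prop} {h p q : ℕ} (hp : HasPeriod F h p) (hq : HasPeriod F h q)
    (hh : p + q ≤ h) : HasPeriod F h (p.gcd q) := by
  induction hm : p + q using Nat.strong_induction_on generalizing p q with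
  | _ m ih =>
    rcases Nat.eq_zero_or_pos p with rfl | hp0
    · simpa using hq
    rcases Nat.eq_zero_or_pos q with rfl | hq0
    · simpa using hp
    rcases le_total p q with hpq | hpq
    · have := ih (p + (q - p)) (by omega) hp (hp.sub hq hpq hh) (by omega) rfl
      rwa [Nat.gcd_sub_self_right hpq] at this
    · have := ih (p - q + q) (by omega) (hq.sub hp hpq (by omega)) hq (by omega) rfl
      rwa [Nat.gcd_sub_self_left hpq] at this

theorem HasPeriod.finset_gcd {ι : Type*} {F : ℕ → Prop} {h N : ℕ} (s : Finset ι) (f : ι → ℕ)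
    (hf : ∀ i ∈ s, HasPeriod F h (f i)) (hN : ∀ i ∈ s, f i ≤ N) (hh : N + N ≤ h) :
    HasPeriod F h (s.gcd f) := by
  classical
  suffices s.gcd f ≤ N ∧ HasPeriod F h (s.gcd f) from this.2
  induction s using Finset.induction_on with
  | empty => exact ⟨by simp, fun x _ => by simp⟩
  | insert a s _ ih =>
    obtain ⟨h1, h2⟩ := ih (fun i hi => hf i (Finset.mem_insert_of_mem hi))
      (fun i hi => hN i (Finset.mem_insert_of_mem hi))
    have ha := hN a (Finset.mem_insert_self _ _)
    rw [Finset.gcd_insert]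
    change (f a).gcd (s.gcd f) ≤ N ∧ HasPeriod F h ((f a).gcd (s.gcd f))
    refine ⟨?_, (hf a (Finset.mem_insert_self _ _)).gcd h2 (by omega)⟩
    rcases Nat.eq_zero_or_pos (f a) with h0 | h0
    · simpa [h0] using h1
    · exact (Nat.gcd_le_left _ h0).trans ha

theorem HasPeriod.add_mul {F : ℕ → Prop} {h d : ℕ} (hd : HasPeriod F h d) (x m : ℕ)
    (hx : x + m * d < h) : F x ↔ F (x + m * d) := by
  induction m with
  | zero => simp
  | succ m ih =>
    rw [Nat.succ_mul] at hx ⊢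
    rw [← Nat.add_assoc]
    exact (ih (by omega)).trans (hd _ (by omega))

theorem HasPeriod.iff_of_dvd {F : ℕ → Prop} {h d x y : ℕ} (hd : HasPeriod F h d)
    (hx : x < h) (hy : y < h) (hxy : (d : ℤ) ∣ (y : ℤ) - x) : F x ↔ F y := by
  wlog hle : x ≤ y generalizing x y
  · exact (this hy hx (by rw [← dvd_neg]; simpa using hxy) (by omega)).symm
  have : d ∣ y - x := by
    rw [← Int.natCast_dvd_natCast, Nat.cast_sub hle]; exact hxy
  obtain ⟨m, hm⟩ := this
  obtain rfl : y = x + m * d := by rw [Nat.mul_comm] at hm; omega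
  exact hd.add_mul x m hy

/-! ### Few generators of a gcd -/

open Classical in
/-- The gcd of a finite family of numbers at most `N` is the gcd of at most `log₂ N + 1` of
them. -/
theorem exists_subset_gcd_eq {ι : Type*} (s : Finset ι) (f : ι → ℕ) (N : ℕ)
    (hN : ∀ i ∈ s, f i ≤ N) :
    ∃ t ⊆ s, t.gcd f = s.gcd f ∧ t.card ≤ Nat.log 2 N + 1 := by
  -- The first kept element has value at most `N`; each later one is kept only if it at least halves
  -- the gcd.
  suffices ∃ t ⊆ s, t.gcd f = s.gcd f ∧ (t = ∅ ∨ 0 < t.gcd f ∧ 2 ^ t.card * t.gcd f ≤ 2 * N) by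
    obtain ⟨t, hts, hg, ht⟩ := this
    refine ⟨t, hts, hg, ?_⟩
    rcases ht with rfl | ⟨h0, hle⟩
    · simp
    · rcases Nat.eq_zero_or_pos t.card with hc | hc
      · omega
      have h2 : 2 ^ t.card ≤ 2 * N := (Nat.le_mul_of_pos_right _ h0).trans hle
      obtain ⟨m, hm⟩ : ∃ m, t.card = m + 1 := ⟨t.card - 1, by omega⟩
      rw [hm, pow_succ] at h2
      have := Nat.le_log_of_pow_le (b := 2) (by norm_num) (show 2 ^ m ≤ N by omega)
      omega
  induction s using Finset.induction_on with
  | empty => exact ⟨∅, by simp, by simp, Or.inl rfl⟩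
  | insert a s has ih =>
    obtain ⟨t, hts, hg, ht⟩ := ih fun i hi => hN i (Finset.mem_insert_of_mem hi)
    have ha := hN a (Finset.mem_insert_self _ _)
    have hgi : ∀ u : Finset ι, (insert a u).gcd f = (f a).gcd (u.gcd f) := fun u =>
      Finset.gcd_insert
    by_cases hdvd : t.gcd f ∣ f a
    · refine ⟨t, hts.trans (Finset.subset_insert _ _), ?_, ht⟩
      rw [hgi, ← hg, Nat.gcd_eq_right hdvd]
    · refine ⟨insert a t, Finset.insert_subset_insert _ hts, by rw [hgi, hgi, hg], Or.inr ?_⟩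
      have hfa : 0 < f a := Nat.pos_of_ne_zero fun h => hdvd (h ▸ dvd_zero _)
      rw [hgi, Finset.card_insert_of_notMem fun h => has (hts h)]
      refine ⟨Nat.gcd_pos_of_pos_left _ hfa, ?_⟩
      rcases ht with rfl | ⟨h0, hle⟩
      · simpa using ha
      · obtain ⟨m, hm⟩ := Nat.gcd_dvd_right (f a) (t.gcd f)
        set g := (f a).gcd (t.gcd f) with hgdef
        have hm2 : 2 ≤ m := by
          by_contra hlt
          have : m = 0 ∨ m = 1 := by omega
          rcases this with rfl | rfl
          · omega
          · rw [mul_one] at hm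
            exact hdvd (hm ▸ Nat.gcd_dvd_left _ _)
        calc 2 ^ (t.card + 1) * g = 2 ^ t.card * (g * 2) := by ring
          _ ≤ 2 ^ t.card * (g * m) := by gcongr
          _ = 2 ^ t.card * t.gcd f := by rw [← hm]
          _ ≤ 2 * N := hle

/-! ### Symbol sets closed under mismatches -/

variable {A : Type*} {n : ℕ}

/-- The string `S`, continued by wildcards. -/
def symbolAt (S : Fin n → Option A) (i : ℕ) : Option A :=
  if h : i < n then S ⟨i, h⟩ else none

theorem symbolAt_mk (S : Fin n → Option A) {i : ℕ} (hi : i < n) : symbolAt S i = S ⟨i, hi⟩ := by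
  simp [symbolAt, hi]

open Classical in
/-- The pairs of different symbols that are compared when `p` is tested for being a candidate. -/
noncomputable def mismatchPairs (S : Fin n → Option A) (p : ℕ) : Finset (Option A × Option A) :=
  ({i : Fin (n / 2) | symbolAt S i ≠ symbolAt S (i + p)} : Finset (Fin (n / 2))).image
    fun i : Fin (n / 2) => (symbolAt S i, symbolAt S (i + p))

theorem card_mismatchPairs_le {S : Fin n → Option A} {k p : ℕ} (hp : IsCandidate S k p) :
    (mismatchPairs S p).card ≤ 2 * k := by
  classical
  obtain ⟨h, hd⟩ := hp
  unfold hammingDist at hd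
  refine Finset.card_image_le.trans (le_trans (Finset.card_le_card fun i hi => ?_) hd)
  have hi2 := i.2
  simpa [substr, symbolAt_mk S (show (i : ℕ) < n by omega),
    symbolAt_mk S (show (i : ℕ) + p < n by omega), Nat.add_comm p] using hi

/-- A set of symbols that is closed under the mismatches of the candidates `T`, and the
predicate of lying in it. -/
theorem exists_closed_symbols {S : Fin n → Option A} {k : ℕ} (T : Finset ℕ)
    (hT : ∀ p ∈ T, IsCandidate S k p) (R : Finset (Option A)) :
    ∃ R' : Finset (Option A), R ⊆ R' ∧ R'.card ≤ R.card + T.card * (2 * k) ∧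
      ∀ p ∈ T, ∀ x < n / 2, (symbolAt S x ∈ R' ↔ symbolAt S (x + p) ∈ R') := by
  classical
  obtain ⟨R', hR, hc, hcl⟩ := exists_closed_superset (T.biUnion (mismatchPairs S)) R
  refine ⟨R', hR, hc.trans ?_, fun p hp x hx => ?_⟩
  · gcongr
    exact Finset.card_biUnion_le_card_mul _ _ _ fun p hp => card_mismatchPairs_le (hT p hp)
  · by_cases heq : symbolAt S x = symbolAt S (x + p)
    · rw [heq]
    · refine hcl (symbolAt S x, symbolAt S (x + p)) (Finset.mem_biUnion.2 ⟨p, hp, ?_⟩)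
      exact Finset.mem_image.2
        ⟨(⟨x, hx⟩ : Fin (n / 2)), Finset.mem_filter.2 ⟨Finset.mem_univ _, heq⟩, rfl⟩

/-- Candidates may be too long for Fine and Wilf on the first half, but their differences are short.
-/
theorem hasPeriod_sub {F : ℕ → Prop} {h p q : ℕ} (hp : ∀ x < h, (F x ↔ F (x + p)))
    (hq : ∀ x < h, (F x ↔ F (x + q))) : HasPeriod F h (q - p) := by
  intro x hx
  by_cases hpq : p ≤ q
  · have h1 := hp _ hx
    rw [show x + (q - p) + p = x + q by omega] at h1
    exact (hq x (by omega)).trans h1.symm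
  · rw [show q - p = 0 by omega, add_zero]

/-! ### Where forced values occur, and how many there are -/

theorem IsForced.unique {S : Fin n → Option A} {t : ℕ} {w : Fin n} {c c' : A}
    (h : IsForced S t w c) (h' : IsForced S t w c') : c = c' := by
  obtain ⟨y, hy, hc⟩ := h.1
  rcases h'.2 y hy with h1 | h1 <;> simp_all

theorem IsForced.congr {S : Fin n → Option A} {t : ℕ} {w u : Fin n} {c : A}
    (h : IsForced S t w c) (hu : ∃ a : ℤ, (u : ℤ) = w + a * t) : IsForced S t u c := by
  obtain ⟨b, hb⟩ := hu
  refine ⟨?_, ?_⟩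
  · obtain ⟨y, ⟨a, ha⟩, hc⟩ := h.1
    exact ⟨y, ⟨a - b, by rw [ha, hb]; ring⟩, hc⟩
  · rintro y ⟨a, ha⟩
    exact h.2 y ⟨a + b, by rw [ha, hb]; ring⟩

/-- The values forced on a class that has two wildcards at distance exactly the period. -/
def pairForcedValues (S : Fin n → Option A) : Set A :=
  {c | ∃ u ∈ wildcards S, ∃ v ∈ wildcards S, IsForced S (v - u : ℕ) u c}

theorem pairForcedValues_finite_and_ncard_le (S : Fin n → Option A) :
    (pairForcedValues S).Finite ∧
      (pairForcedValues S).ncard ≤ (wildcards S).ncard * (wildcards S).ncard := by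
  classical
  let g : Fin n × Fin n → Set A := fun x => {c | IsForced S (x.2 - x.1 : ℕ) x.1 c}
  let o : Fin n × Fin n → Option A := fun x =>
    if h : ∃ c, c ∈ g x then some h.choose else none
  have hsub : some '' pairForcedValues S ⊆ o '' (wildcards S ×ˢ wildcards S) := by
    rintro _ ⟨c, ⟨u, hu, v, hv, hc⟩, rfl⟩
    have hex : ∃ c, c ∈ g (u, v) := ⟨c, hc⟩
    refine ⟨(u, v), ⟨hu, hv⟩, ?_⟩
    simp only [o, dif_pos hex]
    exact congrArg some (IsForced.unique hex.choose_spec hc)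
  have hfin : (o '' (wildcards S ×ˢ wildcards S)).Finite := (Set.toFinite _).image _
  refine ⟨Set.Finite.of_finite_image (hfin.subset hsub) (Option.some_injective A).injOn, ?_⟩
  rw [← Set.ncard_image_of_injective _ (Option.some_injective A), ← Set.ncard_prod]
  exact (Set.ncard_le_ncard hsub hfin).trans (Set.ncard_image_le (Set.toFinite _))

/-- A forced value occurs near the start of its class, unless the class has two neighbouring
wildcards. -/
theorem IsForced.mem_pair_or_exists {S : Fin n → Option A} {t : ℕ} {w : Fin n} {c : A}
    (h : IsForced S t w c) (ht : 0 < t) :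
    c ∈ pairForcedValues S ∨
      symbolAt S (w % t) = some c ∨ w % t + t < n ∧ symbolAt S (w % t + t) = some c := by
  have hmod := Nat.mod_add_div w t
  have hxn : (w : ℕ) % t < n := (Nat.mod_le _ _).trans_lt w.2
  have hx : ∃ a : ℤ, (((⟨w % t, hxn⟩ : Fin n) : ℕ) : ℤ) = (w : ℕ) + a * t := by
    refine ⟨-((w / t : ℕ) : ℤ), ?_⟩
    have : (((w : ℕ) % t : ℕ) : ℤ) + t * ((w / t : ℕ) : ℤ) = (w : ℕ) := by exact_mod_cast hmod
    simp only
    linarith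
  rcases h.2 _ hx with h0 | h0
  swap
  · exact Or.inr (Or.inl (by rw [symbolAt_mk S hxn, h0]))
  have hxc := h.congr hx
  by_cases hxt : (w : ℕ) % t + t < n
  · rcases hxc.2 ⟨w % t + t, hxt⟩ ⟨1, by simp⟩ with h1 | h1
    · refine Or.inl ⟨_, h0, _, h1, ?_⟩
      simpa using hxc
    · exact Or.inr (Or.inr ⟨hxt, by rw [symbolAt_mk S hxt, h1]⟩)
  -- Here the class consists of the single wildcard position `w % t`, so nothing is forced.
  · exfalso
    obtain ⟨y, ⟨a, ha⟩, hc⟩ := hxc.1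
    simp only at ha
    have hlt : (w : ℕ) % t < t := Nat.mod_lt _ ht
    have hy := y.2
    have ha0 : a = 0 := by
      have h1 : a < 1 := by
        by_contra hge
        have : (t : ℤ) ≤ a * t := le_mul_of_one_le_left (by positivity) (by omega)
        omega
      have h2 : -1 < a := by
        by_contra hle
        have : a * t ≤ (-1) * (t : ℤ) := by gcongr; omega
        omega
      omega
    have : y = ⟨w % t, hxn⟩ := by
      apply Fin.ext
      simp only [ha0, zero_mul, add_zero] at ha
      exact_mod_cast ha
    rw [this, h0] at hc
    cases hc

/-- As `t` and `tmin` agree modulo `D`, so do `w - b * t` and `w - b * tmin`. The value `b = -1`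
allows for the second position of the class, `b = n / t + 1` for the shift back by `tmax`. -/
theorem IsForced.mem_pair_or_mem {S : Fin n → Option A} {t tmin tmax D : ℕ} {w : Fin n} {c : A}
    {R : Finset (Option A)} (h : IsForced S t w c) (ht : 0 < t) (htmax : t ≤ tmax)
    (hmax : tmax + n / 2 ≤ n) (hD : (D : ℤ) ∣ t - tmin) (hDmax : (D : ℤ) ∣ tmax - tmin)
    (hR : ∀ x < n / 2, (symbolAt S x ∈ R ↔ symbolAt S (x + tmax) ∈ R))
    (hmid : symbolAt S (n / 2) ∈ R)
    (hrep : ∀ b : ℤ, -1 ≤ b → b ≤ (n / t : ℕ) + 1 → ∀ y < n / 2,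
      (D : ℤ) ∣ y - (w - b * tmin) → symbolAt S y ∈ R) :
    c ∈ pairForcedValues S ∨ some c ∈ R := by
  have hmod : (((w : ℕ) % t : ℕ) : ℤ) + t * ((w / t : ℕ) : ℤ) = (w : ℕ) := by
    exact_mod_cast Nat.mod_add_div w t
  have hdiv : (w : ℕ) / t ≤ n / t := Nat.div_le_div_right w.2.le
  have hlt : (w : ℕ) % t < t := Nat.mod_lt _ ht
  have key : ∀ (y : ℕ) (q : ℤ), (y : ℤ) = w - q * t → -1 ≤ q → q ≤ (n / t : ℕ) →
      y < n / 2 + tmax → symbolAt S y ∈ R := by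
    intro y q hy hq hq' hlt
    rcases lt_trichotomy y (n / 2) with hy2 | rfl | hy2
    · refine hrep q hq (by omega) y hy2 ?_
      rw [hy, show (w : ℤ) - q * t - (w - q * tmin) = -q * (t - tmin) by ring]
      exact hD.mul_left _
    -- This position needs its own seed: for odd `n`, `tmax` can be `n / 2 + 1`, and no shift back
    -- is possible.
    · exact hmid
    · have := hR (y - tmax) (by omega)
      rw [show y - tmax + tmax = y by omega] at this
      refine this.1 (hrep (q + 1) (by omega) (by omega) _ (by omega) ?_)
      rw [Nat.cast_sub (by omega), hy, show (w : ℤ) - q * t - tmax - (w - (q + 1) * tmin) =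
        -q * (t - tmin) - (tmax - tmin) by ring]
      exact (hD.mul_left _).sub hDmax
  rcases h.mem_pair_or_exists ht with h1 | h1 | ⟨hxn, h1⟩
  · exact Or.inl h1
  · right
    rw [← h1]
    exact key _ (((w : ℕ) / t : ℕ) : ℤ) (by linarith) (by linarith [Int.natCast_nonneg ((w : ℕ) / t)])
      (by exact_mod_cast hdiv) (by omega)
  · right
    rw [← h1]
    exact key _ ((((w : ℕ) / t : ℕ) : ℤ) - 1) (by push_cast at hmod ⊢; linarith)
      (by linarith [Int.natCast_nonneg ((w : ℕ) / t)])
      (by have : (((w : ℕ) / t : ℕ) : ℤ) ≤ (n / t : ℕ) := Nat.cast_le.2 hdiv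
          linarith) (by omega)

/-- The number of values forced by a set `H` of periods that lie in one residue class modulo a
period `D` of the first half of the string, up to the mismatches of the candidates `T`. The set
`Z` represents the residue classes of the relevant positions. -/
theorem ncard_forced_le {S : Fin n → Option A} {k tmin tmax D : ℕ}
    (hS : (wildcards S).ncard ≤ k) (T : Finset ℕ) (hT : ∀ p ∈ T, IsCandidate S k p)
    (hmax : tmax ∈ T) (hDn : D < n / 2) (Z : Finset ℤ) (H : Set ℕ)
    (hper : ∀ F : ℕ → Prop, (∀ p ∈ T, ∀ x < n / 2, (F x ↔ F (x + p))) → HasPeriod F (n / 2) D)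
    (hH : ∀ t ∈ H, 0 < t ∧ t ≤ tmax ∧ (D : ℤ) ∣ t - tmin) (hDmax : (D : ℤ) ∣ tmax - tmin)
    (hZ : ∀ w ∈ wildcards S, ∀ t ∈ H, ∀ b : ℤ, -1 ≤ b → b ≤ (n / t : ℕ) + 1 →
      ∃ z ∈ Z, (D : ℤ) ∣ w - b * tmin - z) :
    {c | ∃ t ∈ H, ∃ w ∈ wildcards S, IsForced S t w c}.Finite ∧
      {c | ∃ t ∈ H, ∃ w ∈ wildcards S, IsForced S t w c}.ncard ≤
        k * k + (Z.card + 1 + T.card * (2 * k)) := by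
  classical
  obtain ⟨R, hRsub, hRcard, hR⟩ := exists_closed_symbols T hT
    (insert (symbolAt S (n / 2)) (Z.image fun z : ℤ => symbolAt S (z % D).toNat))
  have hF := hper (fun x => symbolAt S x ∈ R) hR
  obtain ⟨hPfin, hPcard⟩ := pairForcedValues_finite_and_ncard_le S
  have hrep : ∀ z ∈ Z, ∀ y < n / 2, (D : ℤ) ∣ y - z → symbolAt S y ∈ R := by
    intro z hz y hy hyz
    have hmem : symbolAt S (z % D).toNat ∈ R :=
      hRsub (Finset.mem_insert_of_mem (Finset.mem_image_of_mem _ hz))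
    -- For `D = 0` congruence is equality and `z % 0 = z`; otherwise the seed position is below `D <
    -- n / 2`.
    rcases Nat.eq_zero_or_pos D with rfl | hD
    · have : z = y := by
        have := Int.zero_dvd.1 (by simpa using hyz)
        omega
      simpa [this] using hmem
    · have h0 : 0 ≤ z % D := Int.emod_nonneg _ (by omega)
      have h1 : z % D < D := Int.emod_lt_of_pos _ (by omega)
      refine (hF.iff_of_dvd (by omega) hy ?_).1 hmem
      rw [Int.toNat_of_nonneg h0, show (y : ℤ) - z % D = y - z + (z - z % D) by ring]
      exact hyz.add (Int.dvd_self_sub_emod)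
  have hsub : {c | ∃ t ∈ H, ∃ w ∈ wildcards S, IsForced S t w c} ⊆
      pairForcedValues S ∪ some ⁻¹' (R : Set (Option A)) := by
    rintro c ⟨t, ht, w, hw, hc⟩
    obtain ⟨ht0, htmax, htD⟩ := hH t ht
    obtain ⟨hle, -⟩ := hT _ hmax
    refine hc.mem_pair_or_mem ht0 htmax hle htD hDmax (hR _ hmax)
      (hRsub (Finset.mem_insert_self _ _)) fun b hb hb' y hy hyb => ?_
    obtain ⟨z, hz, hzb⟩ := hZ w hw t ht b hb hb'
    refine hrep z hz y hy ?_
    rw [show (y : ℤ) - z = y - (w - b * tmin) + (w - b * tmin - z) by ring]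
    exact hyb.add hzb
  have hRfin : (some ⁻¹' (R : Set (Option A))).Finite :=
    R.finite_toSet.preimage (Option.some_injective A).injOn
  have hfin := hPfin.union hRfin
  refine ⟨hfin.subset hsub, ?_⟩
  have h1 := Set.ncard_le_ncard hsub hfin
  have h2 := Set.ncard_union_le (pairForcedValues S) (some ⁻¹' (R : Set (Option A)))
  have h3 : (some ⁻¹' (R : Set (Option A))).ncard ≤ R.card := by
    rw [← Set.ncard_coe_finset R, ← Set.ncard_image_of_injective _ (Option.some_injective A)]
    exact Set.ncard_le_ncard (Set.image_preimage_subset _ _) R.finite_toSet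
  have h4 := Nat.mul_le_mul hS hS
  have h5 := Finset.card_insert_le (symbolAt S (n / 2)) (Z.image fun z : ℤ => symbolAt S (z % D).toNat)
  have h6 : (Z.image fun z : ℤ => symbolAt S (z % D).toNat).card ≤ Z.card := Finset.card_image_le
  omega

/-! ### Interval width and generating candidates -/

theorem one_lt_width {k j p : ℕ} (hp : p ∈ interval n k j) : 1 < width n k := by
  obtain ⟨h1, h2⟩ := hp
  linarith

theorem logb_two_natCast_nonneg (n : ℕ) : 0 ≤ Real.logb 2 n := by
  rcases Nat.eq_zero_or_pos n with rfl | hn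
  · simp
  · exact Real.logb_nonneg (by norm_num) (by exact_mod_cast hn)

theorem width_denom_lt {k : ℕ} (hW : 1 < width n k) :
    4 * (2 * k * Real.logb 2 n + 1) < n := by
  have := logb_two_natCast_nonneg n
  rwa [width, one_lt_div (by positivity)] at hW

theorem one_le_logb {k : ℕ} (hW : 1 < width n k) : 1 ≤ Real.logb 2 n := by
  have h1 := width_denom_lt hW
  have h2 := logb_two_natCast_nonneg n
  have h3 : (0 : ℝ) ≤ 2 * k * Real.logb 2 n := by positivity
  have h4 : (4 : ℝ) < n := by linarith
  rw [Real.le_logb_iff_rpow_le (by norm_num) (by linarith)]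
  rw [Real.rpow_one]
  linarith

/-- Keeps candidate differences below `n / 12`, which leaves room for Fine and Wilf on the first
half. -/
theorem twelve_mul_width_le {k : ℕ} (hk : 1 ≤ k) (hW : 1 < width n k) :
    12 * width n k ≤ n := by
  have hL := one_le_logb hW
  have hk' : (1 : ℝ) ≤ k := by exact_mod_cast hk
  have h1 : (1 : ℝ) ≤ k * Real.logb 2 n := by nlinarith
  have hden : (12 : ℝ) ≤ 4 * (2 * k * Real.logb 2 n + 1) := by nlinarith
  have h0 : (0 : ℝ) ≤ n / (4 * (2 * k * Real.logb 2 n + 1)) := by positivity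
  have : n / (4 * (2 * k * Real.logb 2 n + 1)) * (4 * (2 * k * Real.logb 2 n + 1)) = (n : ℝ) :=
    div_mul_cancel₀ _ (by linarith)
  rw [width]
  nlinarith

/-- A few candidates already determine the common difference. -/
theorem exists_generating_candidates (S : Fin n → Option A) (k j : ℕ) :
    ∃ T ⊆ candidates S k j, T.card ≤ 2 * (Nat.log 2 n + 1) ∧
      -- `F` comes after `T`: the symbol set behind `F` is built from the mismatches of `T`.
      ∀ (F : ℕ → Prop) (N : ℕ), (∀ p ∈ T, ∀ x < n / 2, (F x ↔ F (x + p))) →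
        (∀ p ∈ T, ∀ q ∈ T, p - q ≤ N) → N + N ≤ n / 2 →
        HasPeriod F (n / 2) (commonDiff S k j) := by
  classical
  obtain ⟨s, hs, hg, hc⟩ := exists_subset_gcd_eq (candidates S k j ×ˢ candidates S k j)
    (fun x => x.1 - x.2) n (by
      rintro ⟨p, q⟩ hx
      have := (Finset.mem_filter.1 (Finset.mem_product.1 hx).1).1
      simp at this ⊢
      omega)
  refine ⟨s.image Prod.fst ∪ s.image Prod.snd, ?_, ?_, ?_⟩
  · refine Finset.union_subset ?_ ?_ <;> refine Finset.image_subset_iff.2 fun x hx => ?_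
    · exact (Finset.mem_product.1 (hs hx)).1
    · exact (Finset.mem_product.1 (hs hx)).2
  · have h1 := Finset.card_union_le (s.image Prod.fst) (s.image Prod.snd)
    have h2 : (s.image Prod.fst).card ≤ s.card := Finset.card_image_le
    have h3 : (s.image Prod.snd).card ≤ s.card := Finset.card_image_le
    omega
  · intro F N hF hN hNn
    rw [commonDiff, ← hg]
    have hmem : ∀ x ∈ s, x.1 ∈ s.image Prod.fst ∪ s.image Prod.snd ∧
        x.2 ∈ s.image Prod.fst ∪ s.image Prod.snd := fun x hx =>
      ⟨Finset.mem_union_left _ (Finset.mem_image_of_mem _ hx),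
        Finset.mem_union_right _ (Finset.mem_image_of_mem _ hx)⟩
    refine HasPeriod.finset_gcd s _ (fun x hx => ?_) (fun x hx => ?_) hNn
    · exact hasPeriod_sub (hF _ (hmem x hx).2) (hF _ (hmem x hx).1)
    · exact hN _ (hmem x hx).1 _ (hmem x hx).2

theorem commonDiff_dvd_sub {S : Fin n → Option A} {k j p q : ℕ} (hp : p ∈ candidates S k j)
    (hq : q ∈ candidates S k j) : commonDiff S k j ∣ p - q :=
  Finset.gcd_dvd (f := fun x : ℕ × ℕ => x.1 - x.2) (b := (p, q)) (Finset.mk_mem_product hp hq)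

theorem commonDiff_le {S : Fin n → Option A} {k j N : ℕ}
    (h : ∀ p ∈ candidates S k j, ∀ q ∈ candidates S k j, p - q ≤ N) : commonDiff S k j ≤ N := by
  by_cases h0 : ∀ x ∈ candidates S k j ×ˢ candidates S k j, x.1 - x.2 = 0
  · have : commonDiff S k j = 0 := Finset.gcd_eq_zero_iff.2 h0
    omega
  · push Not at h0
    obtain ⟨⟨p, q⟩, hx, hne⟩ := h0
    obtain ⟨hp, hq⟩ := Finset.mem_product.1 hx
    exact (Nat.le_of_dvd (Nat.pos_of_ne_zero hne) (commonDiff_dvd_sub hp hq)).trans (h p hp q hq)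

/-! ### The bound for one interval -/

theorem forcedValues_bound {S : Fin n → Option A} {k j : ℕ} (hS : (wildcards S).ncard ≤ k)
    (hne : (forcedValues S k j).Nonempty) :
    (forcedValues S k j).Finite ∧
      ((forcedValues S k j).ncard : ℝ) ≤ 40 * (k : ℝ) ^ 2 * Real.logb 2 n := by
  classical
  obtain ⟨-, -, ⟨tmin, tmax, hmin, hmax, -⟩, w₀, hw₀, -⟩ := hne
  have hk : 1 ≤ k := ((Set.ncard_pos (Set.toFinite _)).2 ⟨w₀, hw₀⟩).trans_le hS
  have hcand : ∀ p ∈ candidates S k j, p ∈ interval n k j ∧ IsCandidate S k p := fun p hp =>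
    (Finset.mem_filter.1 hp).2
  have hminc : tmin ∈ candidates S k j := hmin.1
  have hmaxc : tmax ∈ candidates S k j := hmax.1
  have hW := one_lt_width (hcand _ hminc).1
  have h12 := twelve_mul_width_le hk hW
  have hL := one_le_logb hW
  have hn12 : 12 < n := by
    have : (12 : ℝ) < n := by linarith
    exact_mod_cast this
  have hdiff : ∀ p ∈ candidates S k j, ∀ q ∈ candidates S k j, p - q ≤ n / 12 := by
    intro p hp q hq
    rcases le_total p q with hpq | hpq
    · omega
    have h1 := (hcand p hp).1.2
    have h2 := (hcand q hq).1.1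
    have h3 : (12 : ℝ) * ((p - q : ℕ) : ℝ) ≤ n := by
      rw [Nat.cast_sub hpq]
      linarith
    have h4 : 12 * (p - q) ≤ n := by exact_mod_cast h3
    omega
  have hpile := commonDiff_le hdiff
  have hminpos : 0 < tmin := by
    have h1 := (hcand _ hminc).1.1
    have : (0 : ℝ) ≤ j * width n k := by positivity
    have h2 : (0 : ℝ) < tmin := by linarith
    exact_mod_cast h2
  obtain ⟨T₀, hT₀, hT₀card, hT₀per⟩ := exists_generating_candidates S k j
  set T := insert tmin (insert tmax T₀) with hTdef
  have hTsub : T ⊆ candidates S k j :=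
    Finset.insert_subset hminc (Finset.insert_subset hmaxc hT₀)
  have hTcard : T.card ≤ 2 * (Nat.log 2 n + 1) + 2 := by
    have h2 := Finset.card_insert_le tmax T₀
    exact (Finset.card_insert_le _ _).trans (by omega)
  have hTmax : tmax ∈ T := by simp [T]
  have hTc : ∀ p ∈ T, IsCandidate S k p := fun p hp => (hcand p (hTsub hp)).2
  have hperπ : ∀ F : ℕ → Prop, (∀ p ∈ T, ∀ x < n / 2, (F x ↔ F (x + p))) →
      HasPeriod F (n / 2) (commonDiff S k j) := fun F hF =>
    hT₀per F (n / 12) (fun p hp => hF p (by simp [T, hp]))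
      (fun p hp q hq => hdiff p (hT₀ hp) q (hT₀ hq)) (by omega)
  have hH : ∀ t ∈ progression S k j,
      tmin ≤ t ∧ t ≤ tmax ∧ ((commonDiff S k j : ℕ) : ℤ) ∣ t - tmin := by
    rintro t ⟨u, v, hu, hv, htv, a, rfl⟩
    obtain rfl := hu.unique hmin
    obtain rfl := hv.unique hmax
    exact ⟨by omega, htv, ⟨a, by push_cast; ring⟩⟩
  have hmaxD : ((commonDiff S k j : ℕ) : ℤ) ∣ tmax - tmin := by
    have := Int.natCast_dvd_natCast.2 (commonDiff_dvd_sub hmaxc hminc)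
    rwa [Nat.cast_sub (hmin.2 hmaxc)] at this
  set Wf : Finset (Fin n) := (Set.toFinite (wildcards S)).toFinset with hWf
  have hWfcard : Wf.card ≤ k := by
    rw [hWf, ← Set.ncard_eq_toFinset_card]
    exact hS
  have hWfmem : ∀ w ∈ wildcards S, w ∈ Wf := fun w hw => by simpa [hWf] using hw
  have hlog : (Nat.log 2 n : ℝ) ≤ Real.logb 2 n := by
    have := Real.natLog_le_logb n 2
    simpa using this
  have hk' : (1 : ℝ) ≤ k := by exact_mod_cast hk
  have hkk : (k : ℝ) ≤ k ^ 2 := by nlinarith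
  have hkL : (k : ℝ) ^ 2 ≤ k ^ 2 * Real.logb 2 n := le_mul_of_one_le_right (by positivity) hL
  have hkL' : (k : ℝ) * Real.logb 2 n ≤ k ^ 2 * Real.logb 2 n := by gcongr
  suffices ∃ (D : ℕ) (Z : Finset ℤ), (Z.card : ℝ) ≤ k * (8 * k * Real.logb 2 n + 7) ∧
      D ∣ commonDiff S k j ∧ D < n / 2 ∧
      (∀ F : ℕ → Prop, (∀ p ∈ T, ∀ x < n / 2, (F x ↔ F (x + p))) → HasPeriod F (n / 2) D) ∧
      (∀ w ∈ wildcards S, ∀ t ∈ progression S k j, ∀ b : ℤ, -1 ≤ b → b ≤ (n / t : ℕ) + 1 →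
        ∃ z ∈ Z, (D : ℤ) ∣ w - b * tmin - z) by
    obtain ⟨D, Z, hZcard, hDdvd, hDn, hper, hZ⟩ := this
    have hDdvd' := Int.natCast_dvd_natCast.2 hDdvd
    obtain ⟨hfin, hcard⟩ := ncard_forced_le hS T hTc hTmax hDn Z (progression S k j) hper
      (fun t ht => ⟨hminpos.trans_le (hH t ht).1, (hH t ht).2.1, hDdvd'.trans (hH t ht).2.2⟩)
      (hDdvd'.trans hmaxD) hZ
    refine ⟨hfin, ?_⟩
    have hcard' : ((forcedValues S k j).ncard : ℝ) ≤
        k * k + (Z.card + 1 + T.card * (2 * k)) := by exact_mod_cast hcard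
    have hTcard' : (T.card : ℝ) ≤ 2 * (Real.logb 2 n + 1) + 2 := by
      have : (T.card : ℝ) ≤ 2 * (Nat.log 2 n + 1) + 2 := by exact_mod_cast hTcard
      linarith
    have h2 : (T.card : ℝ) * (2 * k) ≤ (2 * (Real.logb 2 n + 1) + 2) * (2 * k) := by gcongr
    -- With `L = log₂ n`, the total `k² + (8k²L + 7k) + 1 + (2L + 4) * 2k` is at most `29k²L`.
    nlinarith
  -- For `j = 0` the periods can be so small that `n / t` is too large to count shifts; taking
  -- `tmin` into the modulus removes the dependence on `b`.
  rcases Nat.eq_zero_or_pos j with rfl | hj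
  · have hmin12 : tmin ≤ n / 12 := by
      have h1 := (hcand _ hminc).1.2
      have h2 : (12 : ℝ) * tmin ≤ n := by
        norm_num at h1
        linarith
      have h3 : 12 * tmin ≤ n := by exact_mod_cast h2
      omega
    refine ⟨(commonDiff S k 0).gcd tmin, Wf.image fun w : Fin n => ((w : ℕ) : ℤ), ?_,
      Nat.gcd_dvd_left _ _, (Nat.gcd_le_right _ hminpos).trans_lt (by omega), ?_, ?_⟩
    · have h1 : (Wf.image fun w : Fin n => ((w : ℕ) : ℤ)).card ≤ k := Finset.card_image_le.trans hWfcard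
      have h2 : ((Wf.image fun w : Fin n => ((w : ℕ) : ℤ)).card : ℝ) ≤ k := by exact_mod_cast h1
      nlinarith
    · intro F hF
      exact (hperπ F hF).gcd (fun x hx => hF tmin (by simp [T]) x (by omega)) (by omega)
    · intro w hw t _ b _ _
      refine ⟨_, Finset.mem_image_of_mem _ (hWfmem w hw), ?_⟩
      rw [show ((w : ℕ) : ℤ) - b * tmin - (w : ℕ) = -b * tmin by ring]
      exact (Int.natCast_dvd_natCast.2 (Nat.gcd_dvd_right _ _)).mul_left _
  -- `Q` is the floor of `n / width n k` and bounds `n / t`, because `t ≥ width n k` when `j ≥ 1`.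
  · set Q : ℕ := ⌊4 * (2 * k * Real.logb 2 n + 1)⌋₊ with hQ
    have hden : (0 : ℝ) < 4 * (2 * k * Real.logb 2 n + 1) := by positivity
    refine ⟨commonDiff S k j,
      (Wf ×ˢ Finset.Icc (-1 : ℤ) (Q + 1)).image fun x => ((x.1 : ℕ) : ℤ) - x.2 * tmin, ?_,
      dvd_rfl, by omega, hperπ, ?_⟩
    · have h1 : ((Wf ×ˢ Finset.Icc (-1 : ℤ) (Q + 1)).image
          fun x => ((x.1 : ℕ) : ℤ) - x.2 * tmin).card ≤ k * (Q + 3) := by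
        refine Finset.card_image_le.trans ?_
        rw [Finset.card_product, Int.card_Icc,
          show ((Q : ℤ) + 1 + 1 - -1).toNat = Q + 3 by omega]
        gcongr
      have h2 : (Q : ℝ) ≤ 4 * (2 * k * Real.logb 2 n + 1) := Nat.floor_le hden.le
      have h3 : ((((Wf ×ˢ Finset.Icc (-1 : ℤ) (Q + 1)).image
          fun x => ((x.1 : ℕ) : ℤ) - x.2 * tmin).card : ℕ) : ℝ) ≤ k * (Q + 3) := by
        exact_mod_cast h1
      exact h3.trans (mul_le_mul_of_nonneg_left (by linarith) (by positivity))
    · intro w hw t ht b hb hb'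
      refine ⟨_, Finset.mem_image_of_mem _ (a := (w, b))
        (Finset.mk_mem_product (hWfmem w hw) (Finset.mem_Icc.2 ⟨hb, hb'.trans ?_⟩)), by simp⟩
      suffices n / t ≤ Q by omega
      refine Nat.le_floor ?_
      have hj' : (1 : ℝ) ≤ j := by exact_mod_cast hj
      have h1 : width n k ≤ t := by
        have h2 := (hcand _ hminc).1.1
        have h3 : (tmin : ℝ) ≤ t := by exact_mod_cast (hH t ht).1
        nlinarith
      have ht0 : (0 : ℝ) < t := by linarith
      refine Nat.cast_div_le.trans ?_
      rw [width, div_le_iff₀ hden] at h1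
      rw [div_le_iff₀ ht0]
      linarith

end WildcardPeriod

theorem mainTheorem5 :
    ∃ C : ℝ, 0 < C ∧ ∀ (A : Type*) (n k : ℕ) (S : Fin n → Option A),
      (WildcardPeriod.wildcards S).ncard ≤ k → ∀ j : ℕ,
        (WildcardPeriod.forcedValues S k j).Finite ∧
          ((WildcardPeriod.forcedValues S k j).ncard : ℝ) ≤ C * (k : ℝ) ^ 2 * Real.logb 2 n := by
  refine ⟨40, by norm_num, fun A n k S hS j => ?_⟩
  rcases (WildcardPeriod.forcedValues S k j).eq_empty_or_nonempty with h | h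
  · have := WildcardPeriod.logb_two_natCast_nonneg n
    rw [h]
    refine ⟨Set.finite_empty, ?_⟩
    rw [Set.ncard_empty, Nat.cast_zero]
    positivity
  · exact WildcardPeriod.forcedValues_bound hS h
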